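/- For an integer $n\ge 1$ let $\mu(n)=\frac{\pi}{6}\sqrt{24n-1}$. For an integer $n\ge 2$ put $x=\mu(n-1)$, $y=\mu(n)$, $z=\mu(n+1)$ and define $$f(n)=e^{x-2y+z}\,\frac{(x^{10}-x^9-1)\,y^{24}\,(z^{10}-z^9-1)}{x^{12}\,(y^{10}-y^9+1)^2\,z^{12}},\qquad g(n)=e^{x-2y+z}\,\frac{(x^{10}-x^9+1)\,y^{24}\,(z^{10}-z^9+1)}{x^{12}\,(y^{10}-y^9-1)^2\,z^{12}}.$$ Then for every integer $n\ge 2$, $$g(n+1)<f(n)+\frac{110}{\mu(n-1)^5}.$$ -/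

import Mathlib

namespace PartitionBounds

noncomputable section

/-- `μ(n) = (π / 6) √(24 n - 1)`; the subtraction is that of the real numbers. -/
def mu (n : ℕ) : ℝ :=
  Real.pi / 6 * √(24 * (n : ℝ) - 1)

/-- The lower bound `f(n)`, with `x = μ(n-1)`, `y = μ(n)`, `z = μ(n+1)`. It is used for `n ≥ 2`
only, where the index `n - 1` is an honest natural number. -/
def f (n : ℕ) : ℝ :=
  let x := mu (n - 1)
  let y := mu n
  let z := mu (n + 1)
  Real.exp (x - 2 * y + z) *
    (((x ^ 10 - x ^ 9 - 1) * y ^ 24 * (z ^ 10 - z ^ 9 - 1)) /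
      (x ^ 12 * (y ^ 10 - y ^ 9 + 1) ^ 2 * z ^ 12))

/-- The upper bound `g(n)`, with `x = μ(n-1)`, `y = μ(n)`, `z = μ(n+1)`. It is used for `n ≥ 2`
only, where the index `n - 1` is an honest natural number. -/
def g (n : ℕ) : ℝ :=
  let x := mu (n - 1)
  let y := mu n
  let z := mu (n + 1)
  Real.exp (x - 2 * y + z) *
    (((x ^ 10 - x ^ 9 + 1) * y ^ 24 * (z ^ 10 - z ^ 9 + 1)) /
      (x ^ 12 * (y ^ 10 - y ^ 9 - 1) ^ 2 * z ^ 12))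

end

end PartitionBounds

namespace PartitionBounds

/-! Write a, b, c, d for the values of `mu` at n-1, ..., n+2; their squares form a progression with
step h = 2π²/3. Let G = log g(n+1), F = log f(n). Up to the ±1 terms, each rational factor has
logarithm `logMain`, so G - F is the third difference of √s plus that of `logMain`, plus errors. The
first is at most 3h³/(8a⁵) < 106.9/a⁵, the second is nonpositive, and the errors are at most
8/(50a⁵). A second-difference estimate gives G ≤ 1/100, hence e^G - e^F ≤ e^G (G - F) < 110/a⁵. -/

/-- The logarithm of `(1 - 1 / w) / w ^ 2` at `w = √s`. -/
noncomputable def logMain (s : ℝ) : ℝ := Real.log (√s - 1) - 3 / 2 * Real.log s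

/-! ### Third difference of the main logarithm -/

lemma logMain_sq {w : ℝ} (hw : 0 ≤ w) : logMain (w ^ 2) = Real.log (w - 1) - 3 * Real.log w := by
  rw [logMain, Real.sqrt_sq hw, Real.log_pow]
  push_cast
  ring

lemma le_sqrt_of_mem {s : ℝ} (hs : 25 / 4 ≤ s) : 5 / 2 ≤ √s :=
  Real.le_sqrt_of_sq_le (by norm_num; linarith)

lemma hasDerivAt_logMain {s : ℝ} (hs : 25 / 4 ≤ s) :
    HasDerivAt logMain (1 / 2 * (1 / (s - √s)) - 3 / 2 * (1 / s)) s := by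
  have hw := le_sqrt_of_mem hs
  have hs0 : s ≠ 0 := by linarith
  have hw1 : √s - 1 ≠ 0 := by linarith
  have hw0 : √s ≠ 0 := by linarith
  have hss : √s * √s = s := Real.mul_self_sqrt (by linarith)
  have h := (((Real.hasDerivAt_sqrt hs0).sub_const 1).log hw1).sub
    ((Real.hasDerivAt_log hs0).const_mul (3 / 2))
  refine h.congr_deriv ?_
  have h2 : s - √s = √s * (√s - 1) := by linear_combination -hss
  rw [h2]
  field_simp

lemma concaveOn_deriv_logMain :
    ConcaveOn ℝ (Set.Ici (25 / 4 : ℝ)) fun s => 1 / 2 * (1 / (s - √s)) - 3 / 2 * (1 / s) := by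
  have hne : ∀ s : ℝ, 25 / 4 ≤ s → s - √s ≠ 0 := by
    intro s hs
    have hw := le_sqrt_of_mem hs
    have hss : √s * √s = s := Real.mul_self_sqrt (by linarith)
    nlinarith
  have h1 : ∀ s : ℝ, 25 / 4 ≤ s → HasDerivAt (fun s => 1 / 2 * (1 / (s - √s)) - 3 / 2 * (1 / s))
      (1 / 2 * (-(1 - 1 / (2 * √s)) / (s - √s) ^ 2) + 3 / 2 * (1 / s ^ 2)) s := by
    intro s hs
    have hs0 : s ≠ 0 := by linarith
    have h := ((((hasDerivAt_id s).sub (Real.hasDerivAt_sqrt hs0)).inv (hne s hs)).const_mul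
      (1 / 2)).sub ((hasDerivAt_inv hs0).const_mul (3 / 2))
    simp only [one_div] at h ⊢
    refine h.congr_deriv ?_
    simp
  have h2 : ∀ s : ℝ, 25 / 4 ≤ s →
      HasDerivAt (fun s => 1 / 2 * (-(1 - 1 / (2 * √s)) / (s - √s) ^ 2) + 3 / 2 * (1 / s ^ 2))
      ((1 - 1 / (2 * √s)) ^ 2 / (s - √s) ^ 3 - 1 / (8 * √s ^ 3 * (s - √s) ^ 2) - 3 / s ^ 3) s := by
    intro s hs
    have hw := le_sqrt_of_mem hs
    have hs0 : s ≠ 0 := by linarith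
    have hw0 : √s ≠ 0 := by linarith
    have hm := hne s hs
    have hsq := Real.hasDerivAt_sqrt hs0
    have ha : HasDerivAt (fun s => -(1 - 1 / (2 * √s))) (-(1 / (4 * √s ^ 3))) s := by
      have h := (((hsq.const_mul 2).inv (by positivity)).const_sub 1).neg
      simp only [one_div] at h ⊢
      refine h.congr_deriv ?_
      field_simp
      norm_num
    have h := ((ha.div (((hasDerivAt_id s).sub hsq).pow 2) (pow_ne_zero 2 hm)).const_mul
      (1 / 2)).add (((hasDerivAt_pow 2 s).inv (pow_ne_zero 2 hs0)).const_mul (3 / 2))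
    simp only [one_div] at h ⊢
    refine h.congr_deriv ?_
    simp only [Pi.sub_apply, Pi.pow_apply, id]
    generalize √s = w at *
    field_simp
    ring
  refine concaveOn_of_hasDerivWithinAt2_nonpos (convex_Ici _)
    (f' := fun s => 1 / 2 * (-(1 - 1 / (2 * √s)) / (s - √s) ^ 2) + 3 / 2 * (1 / s ^ 2))
    (f'' := fun s => (1 - 1 / (2 * √s)) ^ 2 / (s - √s) ^ 3
      - 1 / (8 * √s ^ 3 * (s - √s) ^ 2) - 3 / s ^ 3)
    (fun s hs => (h1 s hs).continuousAt.continuousWithinAt)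
    (fun s hs => (h1 s (interior_subset hs)).hasDerivWithinAt)
    (fun s hs => (h2 s (interior_subset hs)).hasDerivWithinAt) ?_
  intro s hs
  have hs' : 25 / 4 ≤ s := interior_subset hs
  have hw := le_sqrt_of_mem hs'
  have hss : s = √s ^ 2 := (Real.sq_sqrt (by linarith)).symm
  generalize √s = w at *
  subst hss
  have hw0 : 0 < w := by linarith
  have hw1 : 0 < w - 1 := by linarith
  -- This cubic inequality forces the cutoff: it holds from w = 5/2 on but already fails at w =
  -- 12/5.
  have key : w * ((w - 1 / 2) ^ 2 - (w - 1) / 8) ≤ 3 * (w - 1) ^ 3 := by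
    nlinarith [mul_nonneg (sub_nonneg.2 hw) (sub_nonneg.2 hw), mul_nonneg
      (mul_nonneg (sub_nonneg.2 hw) (sub_nonneg.2 hw)) (sub_nonneg.2 hw)]
  have e : (1 - 1 / (2 * w)) ^ 2 / (w ^ 2 - w) ^ 3 - 1 / (8 * w ^ 3 * (w ^ 2 - w) ^ 2)
      - 3 / (w ^ 2) ^ 3
      = (w * ((w - 1 / 2) ^ 2 - (w - 1) / 8) - 3 * (w - 1) ^ 3) / (w ^ 6 * (w - 1) ^ 3) := by
    have : w ^ 2 - w = w * (w - 1) := by ring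
    rw [this]
    have := hw1.ne'
    field_simp
  rw [e]
  exact div_nonpos_of_nonpos_of_nonneg (by linarith) (by positivity)

/-- Concavity of the derivative makes the second difference, as a function of its base point,
decreasing. -/
lemma third_difference_logMain_nonpos {s h : ℝ} (hs : 25 / 4 ≤ s) (hh : 0 ≤ h) :
    logMain (s + 3 * h) - 3 * logMain (s + 2 * h) + 3 * logMain (s + h) - logMain s ≤ 0 := by
  set D : ℝ → ℝ := fun s => 1 / 2 * (1 / (s - √s)) - 3 / 2 * (1 / s) with hD
  have hder : ∀ t : ℝ, 25 / 4 ≤ t →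
      HasDerivAt (fun t => logMain (t + 2 * h) - 2 * logMain (t + h) + logMain t)
        (D (t + 2 * h) - 2 * D (t + h) + D t) t := by
    intro t ht
    exact (((hasDerivAt_logMain (s := t + 2 * h) (by linarith)).comp_add_const t (2 * h)).sub
      (((hasDerivAt_logMain (s := t + h) (by linarith)).comp_add_const t h).const_mul 2)).add
      (hasDerivAt_logMain ht)
  have hanti : AntitoneOn (fun t => logMain (t + 2 * h) - 2 * logMain (t + h) + logMain t)
      (Set.Ici (25 / 4)) := by
    refine antitoneOn_of_deriv_nonpos (convex_Ici _)
      (fun t ht => (hder t ht).continuousAt.continuousWithinAt)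
      (fun t ht => (hder t (interior_subset ht)).differentiableAt.differentiableWithinAt) ?_
    intro t ht
    have ht' : 25 / 4 ≤ t := interior_subset ht
    rw [(hder t ht').deriv]
    have hc := concaveOn_deriv_logMain.2 (x := t) ht' (y := t + 2 * h)
      (show 25 / 4 ≤ t + 2 * h by linarith)
      (show (0 : ℝ) ≤ 1 / 2 by norm_num) (show (0 : ℝ) ≤ 1 / 2 by norm_num) (by norm_num)
    have e : (1 / 2 : ℝ) • t + (1 / 2 : ℝ) • (t + 2 * h) = t + h := by
      simp only [smul_eq_mul]; ring
    rw [e] at hc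
    change (1 / 2 : ℝ) * D t + (1 / 2 : ℝ) * D (t + 2 * h) ≤ D (t + h) at hc
    linarith
  have := hanti (a := s) hs (b := s + h) (show 25 / 4 ≤ s + h by linarith) (by linarith)
  simp only at this
  rw [show s + h + 2 * h = s + 3 * h by ring, show s + h + h = s + 2 * h by ring] at this
  linarith

/-! ### Differences of square roots, and the second difference of `logMain` -/

/-- Repeated use of v - u = (v² - u²)/(u + v) gives an exact formula with positive sums as
denominators; each is then bounded below by 2a. -/
lemma third_difference_le {a b c d h : ℝ} (ha : 0 < a) (hb : a ≤ b) (hc : a ≤ c) (hd : a ≤ d)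
    (hh : 0 ≤ h) (eb : b ^ 2 = a ^ 2 + h) (ec : c ^ 2 = a ^ 2 + 2 * h)
    (ed : d ^ 2 = a ^ 2 + 3 * h) :
    d - 3 * c + 3 * b - a ≤ 3 * h ^ 3 / (8 * a ^ 5) := by
  have hb0 : 0 < b := by linarith
  have hc0 : 0 < c := by linarith
  have hd0 : 0 < d := by linarith
  have q1 : b - a = h / (a + b) := by
    field_simp; linear_combination eb
  have q2 : c - b = h / (b + c) := by
    field_simp; linear_combination ec - eb
  have q3 : d - c = h / (c + d) := by
    field_simp; linear_combination ed - ec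
  have q4 : c - a = 2 * h / (a + c) := by
    field_simp; linear_combination ec
  have q5 : d - b = 2 * h / (b + d) := by
    field_simp; linear_combination ed - eb
  have q6 : d - a = 3 * h / (a + d) := by
    field_simp; linear_combination ed
  have r1 : c - 2 * b + a = -(2 * h ^ 2 / ((a + b) * (b + c) * (a + c))) := by
    have : c - 2 * b + a = -(h * (c - a) / ((a + b) * (b + c))) := by
      rw [show c - 2 * b + a = (c - b) - (b - a) by ring, q1, q2]
      field_simp; ring
    rw [this, q4]; field_simp
  have r2 : d - 2 * c + b = -(2 * h ^ 2 / ((b + c) * (c + d) * (b + d))) := by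
    have : d - 2 * c + b = -(h * (d - b) / ((b + c) * (c + d))) := by
      rw [show d - 2 * c + b = (d - c) - (c - b) by ring, q2, q3]
      field_simp; ring
    rw [this, q5]; field_simp
  have hnum : (c + d) * (b + d) - (a + b) * (a + c) = 3 * h * (1 + (b + c) / (a + d)) := by
    have : (c + d) * (b + d) - (a + b) * (a + c) = d ^ 2 - a ^ 2 + (b + c) * (d - a) := by ring
    rw [this, q6, ed]; field_simp; ring
  have r3 : d - 3 * c + 3 * b - a = 6 * h ^ 3 * ((1 / (a + d) + 1 / (b + c))
      / ((a + b) * (a + c) * (b + d) * (c + d))) := by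
    rw [show d - 3 * c + 3 * b - a = (d - 2 * c + b) - (c - 2 * b + a) by ring, r1, r2]
    have : -(2 * h ^ 2 / ((b + c) * (c + d) * (b + d))) - -(2 * h ^ 2 / ((a + b) * (b + c) * (a + c)))
      = 2 * h ^ 2 / (b + c) * (((c + d) * (b + d) - (a + b) * (a + c))
        / ((a + b) * (a + c) * (b + d) * (c + d))) := by
      field_simp; ring
    rw [this, hnum]; field_simp; ring
  rw [r3, show 3 * h ^ 3 / (8 * a ^ 5)
    = 6 * h ^ 3 * ((1 / (a + a) + 1 / (a + a)) / ((a + a) * (a + a) * (a + a) * (a + a))) by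
    field_simp; ring]
  gcongr

lemma second_difference_le {b c d h : ℝ} (hb : 0 < b) (hc : 0 < c) (hd : 0 < d)
    (eb : b ^ 2 = c ^ 2 - h) (ed : d ^ 2 = c ^ 2 + h) :
    b - 2 * c + d ≤ -(h ^ 2 / (4 * c ^ 3)) := by
  have hbd : b + d ≤ 2 * c := by
    nlinarith [sq_nonneg (b - d), sq_nonneg (b + d - 2 * c)]
  have q2 : c - b = h / (b + c) := by
    field_simp; linear_combination -eb
  have q3 : d - c = h / (c + d) := by
    field_simp; linear_combination ed
  have q5 : d - b = 2 * h / (b + d) := by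
    field_simp; linear_combination ed - eb
  have r2 : b - 2 * c + d = -(2 * h ^ 2 / ((b + c) * (c + d) * (b + d))) := by
    have : b - 2 * c + d = -(h * (d - b) / ((b + c) * (c + d))) := by
      rw [show b - 2 * c + d = (d - c) - (c - b) by ring, q2, q3]
      field_simp; ring
    rw [this, q5]; field_simp
  rw [r2, neg_le_neg_iff, show h ^ 2 / (4 * c ^ 3) = 2 * h ^ 2 / ((4 * c ^ 2) * (2 * c)) by
    field_simp]
  have : (b + c) * (c + d) ≤ 4 * c ^ 2 := by nlinarith [sq_nonneg (b - d)]
  gcongr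

/-- Split `logMain` as log(1 - 1/w) - 2 log w. The first part contributes at most 0, by b + d ≤ 2c,
convexity of 1/w and AM-GM; the second is log(c⁴/(b²d²)) with b²d² = c⁴ - h². -/
lemma second_difference_logMain_le {b c d h : ℝ} (hb : 1 < b) (hc : 1 < c) (hd : 1 < d)
    (eb : b ^ 2 = c ^ 2 - h) (ed : d ^ 2 = c ^ 2 + h) :
    logMain (b ^ 2) - 2 * logMain (c ^ 2) + logMain (d ^ 2) ≤ h ^ 2 / (c ^ 4 - h ^ 2) := by
  have hbd : b + d ≤ 2 * c := by
    nlinarith [sq_nonneg (b - d), sq_nonneg (b + d - 2 * c)]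
  have hb0 : 0 < b := by linarith
  have hc0 : 0 < c := by linarith
  have hd0 : 0 < d := by linarith
  have hb1 : 0 < b - 1 := by linarith
  have hc1 : 0 < c - 1 := by linarith
  have hd1 : 0 < d - 1 := by linarith
  have hprod : b ^ 2 * d ^ 2 = c ^ 4 - h ^ 2 := by rw [eb, ed]; ring
  have hbdc : b * d ≤ c ^ 2 := by nlinarith [sq_nonneg (b - d)]
  have hfac : Real.log ((b - 1) / b) + Real.log ((d - 1) / d) ≤ 2 * Real.log ((c - 1) / c) := by
    rw [← Real.log_mul (by positivity) (by positivity),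
      show (2 : ℝ) = ((2 : ℕ) : ℝ) by norm_num, ← Real.log_pow]
    apply Real.log_le_log (by positivity)
    have hinv : 2 / c ≤ 1 / b + 1 / d := by
      have h1 : 4 / (b + d) ≤ 1 / b + 1 / d := by
        rw [div_add_div _ _ hb0.ne' hd0.ne', div_le_div_iff₀ (by positivity) (by positivity)]
        nlinarith [sq_nonneg (b - d)]
      have h2 : 4 / (2 * c) ≤ 4 / (b + d) := by gcongr
      calc 2 / c = 4 / (2 * c) := by field_simp; norm_num
        _ ≤ _ := h2.trans h1
    have e : ∀ w : ℝ, 0 < w → (w - 1) / w = 1 - 1 / w := fun w hw => by field_simp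
    have p : 0 < 1 - 1 / b := by rw [← e b hb0]; positivity
    have q : 0 < 1 - 1 / d := by rw [← e d hd0]; positivity
    rw [e b hb0, e c hc0, e d hd0]
    have hs : (1 - 1 / b) + (1 - 1 / d) ≤ 2 * (1 - 1 / c) := by
      rw [show 2 / c = 2 * (1 / c) by ring] at hinv
      linarith
    nlinarith [sq_nonneg ((1 - 1 / b) - (1 - 1 / d))]
  have hrest : 4 * Real.log c - 2 * Real.log b - 2 * Real.log d ≤ h ^ 2 / (c ^ 4 - h ^ 2) := by
    have e : 4 * Real.log c - 2 * Real.log b - 2 * Real.log d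
        = Real.log (c ^ 4 / (b ^ 2 * d ^ 2)) := by
      rw [Real.log_div (by positivity) (by positivity), Real.log_mul (by positivity)
        (by positivity), Real.log_pow, Real.log_pow, Real.log_pow]
      push_cast; ring
    rw [e]
    refine (Real.log_le_sub_one_of_pos (by positivity)).trans_eq ?_
    rw [← hprod, div_sub_one (by positivity), hprod]
    ring
  rw [Real.log_div hb1.ne' hb0.ne', Real.log_div hc1.ne' hc0.ne',
    Real.log_div hd1.ne' hd0.ne'] at hfac
  rw [logMain_sq hb0.le, logMain_sq hc0.le, logMain_sq hd0.le]
  linarith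

/-! ### Cost of the ±1 terms -/

/-- The excess 1/100 over 1 pays for the denominator m - 1 when log(m/(m - 1)) ≤ 1/(m - 1) is used,
m = w⁹(w - 1). -/
lemma perturbation_le {a w : ℝ} (ha : 5 / 2 ≤ a) (hw : a ≤ w) :
    101 / 100 ≤ 1 / (50 * a ^ 5) * (w ^ 9 * (w - 1)) := by
  have ha0 : 0 < a := by linarith
  have h1 : a ^ 9 * (3 / 2) ≤ w ^ 9 * (w - 1) := by
    have : (3 / 2 : ℝ) ≤ w - 1 := by linarith
    have : 0 < w := by linarith
    gcongr
  have h2 : (5 / 2 : ℝ) ^ 4 ≤ a ^ 4 := by gcongr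
  calc (101 / 100 : ℝ) ≤ 1 / 50 * (a ^ 4 * (3 / 2)) := by norm_num at h2; linarith
    _ = 1 / (50 * a ^ 5) * (a ^ 9 * (3 / 2)) := by field_simp
    _ ≤ _ := by gcongr

lemma log_upper {a w : ℝ} (ha : 5 / 2 ≤ a) (hw : a ≤ w) :
    0 < w ^ 10 - w ^ 9 + 1 ∧ Real.log (w ^ 10 - w ^ 9 + 1) - 12 * Real.log w
      ≤ logMain (w ^ 2) + 1 / (50 * a ^ 5) := by
  have hw0 : 0 < w := by linarith
  have hw1 : 0 < w - 1 := by linarith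
  have hp := perturbation_le ha hw
  have hm : 0 < w ^ 9 * (w - 1) := by positivity
  have e : w ^ 10 - w ^ 9 + 1 = w ^ 9 * (w - 1) * (1 + 1 / (w ^ 9 * (w - 1))) := by
    field_simp
  refine ⟨by rw [e]; positivity, ?_⟩
  have hl : Real.log (1 + 1 / (w ^ 9 * (w - 1))) ≤ 1 / (50 * a ^ 5) := by
    refine (Real.log_le_sub_one_of_pos (by positivity)).trans ?_
    rw [add_sub_cancel_left, div_le_iff₀ hm]
    linarith
  rw [e, Real.log_mul hm.ne' (by positivity), Real.log_mul (by positivity) hw1.ne', Real.log_pow,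
    logMain_sq hw0.le]
  push_cast
  linarith

lemma log_lower {a w : ℝ} (ha : 5 / 2 ≤ a) (hw : a ≤ w) :
    0 < w ^ 10 - w ^ 9 - 1 ∧ logMain (w ^ 2) - 1 / (50 * a ^ 5)
      ≤ Real.log (w ^ 10 - w ^ 9 - 1) - 12 * Real.log w := by
  have hw0 : 0 < w := by linarith
  have hw1 : 0 < w - 1 := by linarith
  have ha0 : 0 < a := by linarith
  have hp := perturbation_le ha hw
  have hm : 0 < w ^ 9 * (w - 1) := by positivity
  have hη : 1 / (50 * a ^ 5) ≤ (1 / 1000 : ℝ) := by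
    have h2 : (5 / 2 : ℝ) ^ 5 ≤ a ^ 5 := by gcongr
    norm_num at h2
    gcongr
    linarith
  have hbig : 1000 ≤ w ^ 9 * (w - 1) := by nlinarith
  have e : w ^ 10 - w ^ 9 - 1 = w ^ 9 * (w - 1) - 1 := by ring
  rw [e]
  have hpos : 0 < w ^ 9 * (w - 1) - 1 := by linarith
  refine ⟨hpos, ?_⟩
  have hl : Real.log (w ^ 9 * (w - 1)) - Real.log (w ^ 9 * (w - 1) - 1) ≤ 1 / (50 * a ^ 5) := by
    rw [← Real.log_div hm.ne' hpos.ne']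
    refine (Real.log_le_sub_one_of_pos (by positivity)).trans ?_
    rw [div_sub_one hpos.ne', div_le_iff₀ hpos]
    linarith
  rw [Real.log_mul (by positivity) hw1.ne', Real.log_pow] at hl
  rw [logMain_sq hw0.le]
  push_cast at hl
  linarith

/-! ### Assembly -/

lemma exp_mul_quotient_eq {t p q r x y z : ℝ} (hp : 0 < p) (hq : 0 < q) (hr : 0 < r) (hx : 0 < x)
    (hy : 0 < y) (hz : 0 < z) :
    Real.exp t * ((p * y ^ 24 * r) / (x ^ 12 * q ^ 2 * z ^ 12))
      = Real.exp (t + (Real.log p - 12 * Real.log x) - 2 * (Real.log q - 12 * Real.log y)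
        + (Real.log r - 12 * Real.log z)) := by
  have e : t + (Real.log p - 12 * Real.log x) - 2 * (Real.log q - 12 * Real.log y)
        + (Real.log r - 12 * Real.log z)
      = t + Real.log ((p * y ^ 24 * r) / (x ^ 12 * q ^ 2 * z ^ 12)) := by
    rw [Real.log_div (by positivity) (by positivity), Real.log_mul (by positivity) (by positivity),
      Real.log_mul (by positivity) (by positivity), Real.log_mul (by positivity) (by positivity),
      Real.log_mul (by positivity) (by positivity), Real.log_pow, Real.log_pow, Real.log_pow,
      Real.log_pow]
    push_cast; ring
  rw [e, Real.exp_add, Real.exp_log (by positivity)]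

lemma log_upper_bound_le {c h : ℝ} (hc : 22 / 5 ≤ c) (h1 : 657 / 100 ≤ h) (h2 : h ≤ 658 / 100) :
    h ^ 2 / (c ^ 4 - h ^ 2) - h ^ 2 / (4 * c ^ 3) ≤ 9 / 1000 := by
  have hk2 : h ^ 2 ≤ 433 / 10 := by nlinarith
  have hk0 : 0 ≤ h ^ 2 := sq_nonneg h
  generalize h ^ 2 = k at *
  have h3 : 85 ≤ c ^ 3 := by
    have : (22 / 5 : ℝ) ^ 3 ≤ c ^ 3 := by gcongr
    norm_num at this; linarith
  have h4 : 374 ≤ c ^ 4 := by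
    have : (22 / 5 : ℝ) ^ 4 ≤ c ^ 4 := by gcongr
    norm_num at this; linarith
  have hc4 : 22 / 5 * c ^ 3 ≤ c ^ 4 := by
    rw [show c ^ 4 = c * c ^ 3 by ring]; gcongr
  have hp3 : 0 < 4 * c ^ 3 := by linarith
  have hp4 : 0 < c ^ 4 - k := by linarith
  rw [div_sub_div _ _ hp4.ne' hp3.ne', div_le_iff₀ (by positivity)]
  have l : k * (4 * c ^ 3) - (c ^ 4 - k) * k ≤ 433 / 10 * 10 := by
    have : k * (4 * c ^ 3 - c ^ 4 + k) ≤ k * 10 := by gcongr; linarith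
    nlinarith
  have r : (330 : ℝ) * (4 * 85) ≤ (c ^ 4 - k) * (4 * c ^ 3) := by
    gcongr; linarith
  linarith

lemma exp_lt_exp_add {G F u : ℝ} (hGF : G - F ≤ 1071 / 10 * u) (hG : G ≤ 1 / 100) (hu : 0 < u) :
    Real.exp G < Real.exp F + 110 * u := by
  have hexpG : Real.exp G ≤ 100 / 99 := by
    -- 1 - G ≤ e^(-G) gives e^G ≤ 1/(1 - G) ≤ 100/99, and 107.1 · 100/99 < 110.
    have h := Real.add_one_le_exp (-G)
    rw [Real.exp_neg] at h
    rw [← inv_le_inv₀ (by norm_num) (Real.exp_pos G)]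
    norm_num
    linarith
  have hexpF : Real.exp G * (1 - 1071 / 10 * u) ≤ Real.exp F := by
    have h := Real.add_one_le_exp (F - G)
    calc Real.exp G * (1 - 1071 / 10 * u) ≤ Real.exp G * Real.exp (F - G) := by
          gcongr; linarith
      _ = Real.exp F := by rw [← Real.exp_add]; congr 1; ring
  have : Real.exp G * u ≤ 100 / 99 * u := by gcongr
  linarith

theorem quotient_bound {a b c d h : ℝ} (ha : 5 / 2 ≤ a) (hb : 0 < b) (hc : 0 < c) (hd : 0 < d)
    (h1 : 657 / 100 ≤ h) (h2 : h ≤ 658 / 100)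
    (eb : b ^ 2 = a ^ 2 + h) (ec : c ^ 2 = a ^ 2 + 2 * h) (ed : d ^ 2 = a ^ 2 + 3 * h) :
    Real.exp (b - 2 * c + d) * (((b ^ 10 - b ^ 9 + 1) * c ^ 24 * (d ^ 10 - d ^ 9 + 1)) /
      (b ^ 12 * (c ^ 10 - c ^ 9 - 1) ^ 2 * d ^ 12)) <
    Real.exp (a - 2 * b + c) * (((a ^ 10 - a ^ 9 - 1) * b ^ 24 * (c ^ 10 - c ^ 9 - 1)) /
      (a ^ 12 * (b ^ 10 - b ^ 9 + 1) ^ 2 * c ^ 12)) + 110 / a ^ 5 := by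
  have ha0 : 0 < a := by linarith
  have hab : a ≤ b := by nlinarith
  have hac : a ≤ c := by nlinarith
  have had : a ≤ d := by nlinarith
  have hc' : 22 / 5 ≤ c := by nlinarith
  obtain ⟨pb, ub⟩ := log_upper ha hab
  obtain ⟨pd, ud⟩ := log_upper ha had
  obtain ⟨pc, lc⟩ := log_lower ha hac
  obtain ⟨pa, la⟩ := log_lower ha le_rfl
  rw [exp_mul_quotient_eq pb pc pd hb hc hd, exp_mul_quotient_eq pa pb pc ha0 hb hc]
  have hT := third_difference_logMain_nonpos (s := a ^ 2) (h := h) (by nlinarith) (by linarith)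
  rw [← eb, ← ec, ← ed] at hT
  have hD := third_difference_le ha0 hab hac had (by linarith) eb ec ed
  have hS := second_difference_le hb hc hd (h := h) (by linarith) (by linarith)
  have hM := second_difference_logMain_le (b := b) (c := c) (d := d) (h := h) (by linarith)
    (by linarith) (by linarith) (by linarith) (by linarith)
  have hE := log_upper_bound_le hc' h1 h2
  have h5 : (97 : ℝ) ≤ a ^ 5 := by
    have : (5 / 2 : ℝ) ^ 5 ≤ a ^ 5 := by gcongr
    norm_num at this; linarith
  have hh3 : 3 * h ^ 3 / (8 * a ^ 5) ≤ 1069 / 10 * (1 / a ^ 5) := by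
    have : h ^ 3 ≤ (658 / 100) ^ 3 := by gcongr
    rw [mul_one_div, div_le_div_iff₀ (by positivity) (by positivity)]
    nlinarith
  have hη : 1 / (50 * a ^ 5) = 1 / 50 * (1 / a ^ 5) := by field_simp
  rw [hη] at ub ud lc la
  have hu : 1 / a ^ 5 ≤ 1 / 97 := by gcongr
  have hu0 : 0 < 1 / a ^ 5 := by positivity
  rw [show 110 / a ^ 5 = 110 * (1 / a ^ 5) by ring]
  generalize 1 / a ^ 5 = u at *
  set G := b - 2 * c + d + (Real.log (b ^ 10 - b ^ 9 + 1) - 12 * Real.log b)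
    - 2 * (Real.log (c ^ 10 - c ^ 9 - 1) - 12 * Real.log c)
    + (Real.log (d ^ 10 - d ^ 9 + 1) - 12 * Real.log d) with hG
  set F := a - 2 * b + c + (Real.log (a ^ 10 - a ^ 9 - 1) - 12 * Real.log a)
    - 2 * (Real.log (b ^ 10 - b ^ 9 + 1) - 12 * Real.log b)
    + (Real.log (c ^ 10 - c ^ 9 - 1) - 12 * Real.log c) with hF
  -- The error weights 1, 2, 1 occur twice: 106.9 + 8/50 < 107.1.
  have hGF : G - F ≤ 1071 / 10 * u := by linarith
  -- Here 9/1000 + (4/50)/97 < 1/100.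
  have hG1 : G ≤ 1 / 100 := by linarith
  exact exp_lt_exp_add hGF hG1 hu0

lemma mu_sq {n : ℕ} (hn : 1 ≤ n) : mu n ^ 2 = Real.pi ^ 2 / 36 * (24 * (n : ℝ) - 1) := by
  have : (1 : ℝ) ≤ n := by exact_mod_cast hn
  rw [mu, mul_pow, Real.sq_sqrt (by linarith)]
  ring

lemma mu_pos {n : ℕ} (hn : 1 ≤ n) : 0 < mu n := by
  have : (1 : ℝ) ≤ n := by exact_mod_cast hn
  have := Real.sqrt_pos.2 (show (0 : ℝ) < 24 * n - 1 by linarith)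
  have := Real.pi_pos
  unfold mu
  positivity

end PartitionBounds

theorem mainTheorem5 (n : ℕ) (hn : 2 ≤ n) :
    PartitionBounds.g (n + 1) <
      PartitionBounds.f n + 110 / PartitionBounds.mu (n - 1) ^ 5 := by
  obtain ⟨m, rfl⟩ : ∃ m, n = m + 1 := ⟨n - 1, by omega⟩
  have hm : 1 ≤ m := by omega
  have hm' : (1 : ℝ) ≤ m := by exact_mod_cast hm
  have p1 := Real.pi_gt_d4
  have p2 := Real.pi_lt_d4
  have hsq1 : 98690 / 10000 ≤ Real.pi ^ 2 := by nlinarith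
  have hsq2 : Real.pi ^ 2 ≤ 98697 / 10000 := by nlinarith
  have ea := PartitionBounds.mu_sq hm
  have eb := PartitionBounds.mu_sq (n := m + 1) (by omega)
  have ec := PartitionBounds.mu_sq (n := m + 1 + 1) (by omega)
  have ed := PartitionBounds.mu_sq (n := m + 1 + 1 + 1) (by omega)
  push_cast at eb ec ed
  have ha := PartitionBounds.mu_pos hm
  refine PartitionBounds.quotient_bound (h := 2 * Real.pi ^ 2 / 3) ?_
    (PartitionBounds.mu_pos (by omega)) (PartitionBounds.mu_pos (by omega))
    (PartitionBounds.mu_pos (by omega)) (by linarith) (by linarith) ?_ ?_ ?_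
  -- The extreme case is m = 1, where 23π²/36 ≈ 6.31.
  · have : (25 / 4 : ℝ) ≤ PartitionBounds.mu m ^ 2 := by rw [ea]; nlinarith
    change 5 / 2 ≤ PartitionBounds.mu m
    nlinarith
  · simp only [Nat.add_sub_cancel]; rw [eb, ea]; ring
  · simp only [Nat.add_sub_cancel]; rw [ec, ea]; ring
  · simp only [Nat.add_sub_cancel]; rw [ed, ea]; ring
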